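/- Let $G$ be a finite simple graph. For $S\subseteq V(G)$ let $N(S)=\bigcup_{v\in S}N(v)$. Let $\operatorname{core}(G)$ and $\operatorname{corona}(G)$ be the intersection and the union, respectively, of all maximum independent sets of $G$. An independent set $I$ is critical if $|I|-|N(I)|\ge |J|-|N(J)|$ for every independent set $J$ of $G$, and a maximum critical independent set is a critical independent set of largest cardinality. Let $L(G)=J\cup N(J)$, where $J$ is a maximum critical independent set of $G$ (by a theorem of Larson, $L(G)$ does not depend on the choice of $J$), and let $L_G^c=G[V(G)\setminus L(G)]$ be the subgraph induced by the remaining vertices. Suppose that $L_G^c$ has at most two odd cycles (cycles being counted as subgraphs). Then $V(G)$ is the disjoint union of $\operatorname{corona}(G)$ and $N(\operatorname{core}(G))$ if and only if $L_G^c$ does not have two odd cycles sharing exactly one vertex. -/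

import Mathlib

namespace CoreCorona

variable {V : Type*}

/-- The neighborhood `N(S)`, the union of the neighborhoods of the vertices of `S`
(it may meet `S`). -/
def nbhd (G : SimpleGraph V) (S : Set V) : Set V :=
  ⋃ v ∈ S, G.neighborSet v

/-- The intersection of all maximum independent sets. -/
def core [Finite V] (G : SimpleGraph V) : Set V :=
  {v | ∀ S : Finset V, G.IsMaximumIndepSet S → v ∈ S}

/-- The union of all maximum independent sets. -/
def corona [Finite V] (G : SimpleGraph V) : Set V :=
  {v | ∃ S : Finset V, G.IsMaximumIndepSet S ∧ v ∈ S}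

/-- An independent set `I` is critical if it maximizes `|I| - |N(I)|` (an integer) among all
independent sets. -/
def IsCriticalIndepSet (G : SimpleGraph V) (I : Set V) : Prop :=
  G.IsIndepSet I ∧ ∀ J : Set V, G.IsIndepSet J →
    (J.ncard : ℤ) - ((nbhd G J).ncard : ℤ) ≤ (I.ncard : ℤ) - ((nbhd G I).ncard : ℤ)

/-- A critical independent set of maximum cardinality. -/
def IsMaximumCriticalIndepSet (G : SimpleGraph V) (I : Set V) : Prop :=
  IsCriticalIndepSet G I ∧ ∀ J : Set V, IsCriticalIndepSet G J → J.ncard ≤ I.ncard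

/-- `L` is the König–Egerváry part `L(G)` of Larson's independence decomposition of `G`:
`L = J ∪ N(J)` for a maximum critical independent set `J`. (By Larson's theorem `L` does not
depend on `J`; this is not assumed here.) -/
def IsLarsonSet (G : SimpleGraph V) (L : Set V) : Prop :=
  ∃ J : Set V, IsMaximumCriticalIndepSet G J ∧ L = J ∪ nbhd G J

/-- The odd cycles of `G`, as subgraphs. -/
def oddCycles (G : SimpleGraph V) : Set G.Subgraph :=
  {C | ∃ (v : V) (c : G.Walk v v), c.IsCycle ∧ Odd c.length ∧ c.toSubgraph = C}

/-- `G` has two odd cycles whose vertex sets meet in exactly one vertex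
(such cycles are automatically distinct). -/
def HasOddCyclesSharingOneVertex (G : SimpleGraph V) : Prop :=
  ∃ C₁ ∈ oddCycles G, ∃ C₂ ∈ oddCycles G, ∃ x : V, C₁.verts ∩ C₂.verts = {x}

/-- Every finite graph has a Larson set. -/
theorem exists_isLarsonSet [Finite V] (G : SimpleGraph V) : ∃ L : Set V, IsLarsonSet G L := by
  obtain ⟨I, hI, hmax⟩ := Set.exists_max_image {I : Set V | G.IsIndepSet I}
    (fun I => (I.ncard : ℤ) - ((nbhd G I).ncard : ℤ)) (Set.toFinite _)
    ⟨∅, by simp [SimpleGraph.IsIndepSet]⟩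
  obtain ⟨J, hJ, hJmax⟩ := Set.exists_max_image {I : Set V | IsCriticalIndepSet G I}
    (fun I => I.ncard) (Set.toFinite _) ⟨I, hI, hmax⟩
  exact ⟨_, J, ⟨hJ, hJmax⟩, rfl⟩

end CoreCorona

/-! Outside `L` every nonempty independent set has more neighbors than elements (`Expanding`):
otherwise joining it to the maximum critical set `J` would give a larger critical set. Maximum
independent sets of `G` restrict to maximum ones of `H = G - L`, and adjoining `J` goes back, so off
`L` the corona and N(core) are those of `H`. On `L` a Hall argument between N(`J`) and `J` shows
that they always cover. Disjointness is automatic, so it remains to decide when they cover `H`.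

If `x` lies on all odd cycles of `H`, then `H - x` is bipartite, and expansion makes its sides
equally large and both maximum independent. So the core is empty and only `x` can be missed; two
such vertices leave nothing missed. If two odd cycles share exactly `x`, then `x` is missed:
deleting one suitable edge at `x` from each cycle gives a 2-coloring incompatible with a maximum
independent set through `x` (`Expanding.notMem_corona`).

The hard case is two disjoint odd cycles. Deleting a vertex other than `v` from each puts `v` into a
maximum independent set, or else yields an independent `S` with |V| = 2|S| + 1. Then proper subsets
of the complement of `S` satisfy Hall's condition into `S`, and independent sets attaining equality
("tight" sets) lie in the corona. If `v` were uncovered, tight independent sets would cover the rest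
of the complement. Recording which of them contain a fixed vertex properly 2-colors an odd cycle
avoiding `v`, which is absurd (`Expanding.false_of_notMem_verts`). -/

namespace CoreCorona

/-! ### Odd cycles and 2-colorings -/

section OddCycles

variable {V : Type*} {G : SimpleGraph V}

open SimpleGraph

/-- A path whose endpoints are joined by one of its own edges consists of that edge. -/
theorem length_eq_one_of_mem_edges {u v : V} (p : G.Walk v u) (hp : p.IsPath)
    (h : s(u, v) ∈ p.edges) : p.length = 1 := by
  cases p with
  | nil => simp at h
  | cons e q =>
    rw [Walk.cons_isPath_iff] at hp
    rw [Walk.edges_cons, List.mem_cons] at h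
    rcases h with h | h
    · rw [Sym2.eq_swap, Sym2.congr_right] at h
      subst h
      have := (Walk.isPath_iff_nil.1 hp.1).eq_nil
      simp [this]
    · exact absurd (Walk.snd_mem_support_of_mem_edges _ h) hp.2

/-- In a graph without odd cycles, bypassing preserves the parity of the length of a walk. -/
theorem even_length_add_length_bypass [DecidableEq V]
    (h : ∀ (v : V) (c : G.Walk v v), c.IsCycle → Even c.length) {u v : V} (p : G.Walk u v) :
    Even (p.length + p.bypass.length) := by
  induction p with
  | nil => simp [Walk.bypass]
  | @cons u v w e p ih =>
    rw [Walk.bypass]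
    by_cases hs : u ∈ p.bypass.support
    · simp only [hs, dif_pos]
      have hl := congrArg Walk.length (p.bypass.take_spec hs)
      rw [Walk.length_append] at hl
      have hpath : (p.bypass.takeUntil u hs).IsPath := p.bypass_isPath.takeUntil hs
      -- The piece cut off by the bypass is either one edge walked back and forth or a genuine
      -- cycle, so it is even.
      have heven : Even ((p.bypass.takeUntil u hs).length + 1) := by
        by_cases he : s(u, v) ∈ (p.bypass.takeUntil u hs).edges
        · rw [length_eq_one_of_mem_edges _ hpath he]
          decide
        · have := h u (Walk.cons e (p.bypass.takeUntil u hs))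
            ((Walk.cons_isCycle_iff _ e).2 ⟨hpath, he⟩)
          simpa using this
      rw [Walk.length_cons]
      rw [Nat.even_iff] at *
      omega
    · simp only [hs, dif_neg, not_false_eq_true, Walk.length_cons]
      rw [Nat.even_iff] at *
      omega

/-- A graph without odd cycles is bipartite. -/
theorem colorable_two_of_forall_isCycle_even
    (h : ∀ (v : V) (c : G.Walk v v), c.IsCycle → Even c.length) : G.Colorable 2 := by
  classical
  rw [two_colorable_iff_forall_loop_even]
  intro u w
  have := even_length_add_length_bypass h w
  rwa [(Walk.isPath_iff_nil.1 w.bypass_isPath).eq_nil, Walk.length_nil, add_zero] at this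

/-- If every odd cycle has an edge violating `R`, the edges satisfying `R` form a bipartite graph. -/
theorem exists_twoColoring (R : V → V → Prop) (hR : ∀ a b, R a b → R b a)
    (h : ∀ C ∈ oddCycles G, ∃ a b, C.Adj a b ∧ ¬ R a b) :
    ∃ g : V → Bool, ∀ a b, G.Adj a b → R a b → g a ≠ g b := by
  let K : SimpleGraph V :=
    { Adj := fun a b => G.Adj a b ∧ R a b
      symm := ⟨fun a b hab => ⟨hab.1.symm, hR _ _ hab.2⟩⟩
      loopless := ⟨fun a ha => G.irrefl ha.1⟩ }
  have hK : K ≤ G := fun a b hab => hab.1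
  have hcol : K.Colorable 2 := by
    refine colorable_two_of_forall_isCycle_even fun v c hc => ?_
    by_contra hodd
    rw [Nat.not_even_iff_odd] at hodd
    obtain ⟨a, b, hab, hn⟩ := h (c.mapLe hK).toSubgraph
      ⟨v, c.mapLe hK, hc.mapLe hK, by simpa using hodd, rfl⟩
    rw [Walk.adj_toSubgraph_iff_mem_edges, Walk.edges_mapLe_eq_edges] at hab
    exact hn (c.adj_of_mem_edges hab).2
  obtain ⟨f⟩ := hcol
  refine ⟨fun v => decide (f v = 0), fun a b hab hr he => ?_⟩
  have hne : f a ≠ f b := f.valid (show K.Adj a b from ⟨hab, hr⟩)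
  have h2 : ∀ i j : Fin 2, i ≠ j → decide (i = 0) ≠ decide (j = 0) := by decide
  exact h2 _ _ hne he

theorem even_length_iff_of_twoColoring (g : V → Bool) {u v : V} (p : G.Walk u v)
    (hg : ∀ a b, p.toSubgraph.Adj a b → g a ≠ g b) : Even p.length ↔ g u = g v := by
  induction p with
  | nil => simp
  | @cons u v w e p ih =>
    have h1 := hg u v (by simp [Walk.toSubgraph])
    have h2 := ih fun a b hab => hg a b (by
      rw [Walk.toSubgraph, Subgraph.sup_adj]
      exact Or.inr hab)
    rw [Walk.length_cons, Nat.even_add_one, h2]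
    revert h1
    cases g u <;> cases g v <;> cases g w <;> simp

/-- Every 2-coloring has a monochromatic edge on each odd cycle. -/
theorem exists_adj_eq_of_mem_oddCycles {C : G.Subgraph} (hC : C ∈ oddCycles G) (g : V → Bool) :
    ∃ a b, C.Adj a b ∧ g a = g b := by
  by_contra! hn
  obtain ⟨v, c, -, hodd, rfl⟩ := hC
  exact Nat.not_even_iff_odd.2 hodd ((even_length_iff_of_twoColoring g c hn).2 rfl)

theorem exists_adj_of_mem_verts {C : G.Subgraph} (hC : C ∈ oddCycles G) {x : V}
    (hx : x ∈ C.verts) : ∃ b, C.Adj x b := by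
  obtain ⟨v, c, hc, -, rfl⟩ := hC
  have := hc.ncard_neighborSet_toSubgraph_eq_two (c.mem_verts_toSubgraph.1 hx)
  obtain ⟨b, hb⟩ := Set.nonempty_of_ncard_ne_zero (by rw [this]; decide)
  exact ⟨b, hb⟩

end OddCycles

/-! ### Hall-type counting, expanding graphs, and a vertex common to all odd cycles -/

section Expanding

variable {V : Type*} {G : SimpleGraph V}

open SimpleGraph Finset
open scoped Classical

/-- The vertices of `A` with a neighbor in `Z`. -/
noncomputable def nbrIn (G : SimpleGraph V) (A Z : Finset V) : Finset V :=
  {a ∈ A | ∃ z ∈ Z, G.Adj z a}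

theorem mem_nbrIn {A Z : Finset V} {a : V} : a ∈ nbrIn G A Z ↔ a ∈ A ∧ ∃ z ∈ Z, G.Adj z a := by
  simp [nbrIn]

theorem nbrIn_mono {A Z W : Finset V} (h : Z ⊆ W) : nbrIn G A Z ⊆ nbrIn G A W := by
  intro a ha
  obtain ⟨h1, z, hz, h2⟩ := mem_nbrIn.1 ha
  exact mem_nbrIn.2 ⟨h1, z, h hz, h2⟩

theorem nbrIn_union (A Z W : Finset V) :
    nbrIn G A (Z ∪ W) = nbrIn G A Z ∪ nbrIn G A W := by
  ext a
  simp only [mem_nbrIn, mem_union]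
  grind

/-- Sets `Z` satisfying Hall's inequality with equality are closed under union and
intersection, and their neighborhoods intersect accordingly. -/
theorem tight_union_inter {A Z W : Finset V} (hall : ∀ Y ⊆ Z ∪ W, #Y ≤ #(nbrIn G A Y))
    (hZ : #(nbrIn G A Z) ≤ #Z) (hW : #(nbrIn G A W) ≤ #W) :
    #(nbrIn G A (Z ∪ W)) ≤ #(Z ∪ W) ∧ #(nbrIn G A (Z ∩ W)) ≤ #(Z ∩ W) ∧
      nbrIn G A (Z ∩ W) = nbrIn G A Z ∩ nbrIn G A W := by
  have hsub : nbrIn G A (Z ∩ W) ⊆ nbrIn G A Z ∩ nbrIn G A W :=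
    subset_inter (nbrIn_mono inter_subset_left) (nbrIn_mono inter_subset_right)
  have h1 := card_union_add_card_inter Z W
  have h2 := card_union_add_card_inter (nbrIn G A Z) (nbrIn G A W)
  -- The size of the neighborhood is submodular, so the two tight inequalities for `Z` and `W`
  -- squeeze those for the union and the intersection into equalities.
  have h3 := hall (Z ∪ W) subset_rfl
  have h4 := hall (Z ∩ W) (inter_subset_left.trans subset_union_left)
  have h5 := card_le_card hsub
  rw [← nbrIn_union] at h2
  exact ⟨by omega, by omega, eq_of_subset_of_card_le hsub (by omega)⟩

theorem tight_biUnion {A P : Finset V} (hall : ∀ Y ⊆ P, #Y ≤ #(nbrIn G A Y))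
    (F : Finset (Finset V)) (hF : ∀ Z ∈ F, Z ⊆ P ∧ #(nbrIn G A Z) ≤ #Z) :
    F.biUnion id ⊆ P ∧ #(nbrIn G A (F.biUnion id)) ≤ #(F.biUnion id) := by
  induction F using Finset.induction_on with
  | empty => simp [nbrIn]
  | insert Z F hZ ih =>
    obtain ⟨h1, h2⟩ := ih fun W hW => hF W (mem_insert_of_mem hW)
    obtain ⟨h3, h4⟩ := hF Z (mem_insert_self _ _)
    rw [biUnion_insert, id]
    exact ⟨union_subset h3 h1,
      (tight_union_inter (fun Y hY => hall Y (hY.trans (union_subset h3 h1))) h4 h2).1⟩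

/-- Every nonempty independent set has more neighbors than elements. -/
def Expanding [Fintype V] (G : SimpleGraph V) : Prop :=
  ∀ I : Finset V, I.Nonempty → G.IsIndepSet I → #I < #(nbrIn G univ I)

theorem isIndepSet_iff_forall {I : Finset V} :
    G.IsIndepSet I ↔ ∀ a ∈ I, ∀ b ∈ I, ¬ G.Adj a b := by
  constructor
  · intro h a ha b hb hab
    exact h ha hb hab.ne hab
  · intro h a ha b hb _
    exact h a ha b hb

/-- Coloring by membership in `Y`, a monochromatic edge of `C` must lie in `X ∪ {x}`, hence join `x`
to `X`. -/
theorem exists_adj_mem_of_bipartition {C : G.Subgraph} (hC : C ∈ oddCycles G) {x : V}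
    {X Y : Finset V} (iX : ∀ a ∈ X, ∀ b ∈ X, ¬ G.Adj a b) (iY : ∀ a ∈ Y, ∀ b ∈ Y, ¬ G.Adj a b)
    (hXY : ∀ v, v ≠ x → v ∈ X ∨ v ∈ Y) (hxY : x ∉ Y) : ∃ p ∈ X, C.Adj x p := by
  obtain ⟨a, b, hab, he⟩ := exists_adj_eq_of_mem_oddCycles hC (fun v => decide (v ∈ Y))
  simp only [decide_eq_decide] at he
  by_cases ha : a ∈ Y
  · exact absurd hab.adj_sub (iY a ha b (he.1 ha))
  have hb := mt he.2 ha
  rcases eq_or_ne a x with rfl | hax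
  · exact ⟨b, (hXY b hab.adj_sub.ne').resolve_right hb, hab⟩
  rcases eq_or_ne b x with rfl | hbx
  · exact ⟨a, (hXY a hax).resolve_right ha, hab.symm⟩
  · exact absurd hab.adj_sub
      (iX a ((hXY a hax).resolve_right ha) b ((hXY b hbx).resolve_right hb))

variable [Fintype V]

theorem Expanding.card_lt (hG : Expanding G) {I W : Finset V} (hne : I.Nonempty)
    (hI : G.IsIndepSet I) (h : ∀ a ∈ I, ∀ b, G.Adj a b → b ∈ W) : #I < #W := by
  refine (hG I hne hI).trans_le (card_le_card fun b hb => ?_)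
  obtain ⟨-, z, hz, hzb⟩ := mem_nbrIn.1 hb
  exact h z hz b hzb

theorem Expanding.two_mul_card_lt (hG : Expanding G) {I : Finset V} (hne : I.Nonempty)
    (hI : G.IsIndepSet I) : 2 * #I < Fintype.card V := by
  have h := hG.card_lt (W := Iᶜ) hne hI fun a ha b hab =>
    mem_compl.2 fun hb => isIndepSet_iff_forall.1 hI a ha b hb hab
  rw [card_compl] at h
  omega

/-- No independent set reaches half of the vertices, so missing half by at most one vertex is
already optimal. -/
theorem Expanding.isMaximumIndepSet (hG : Expanding G) {S : Finset V} (hS : G.IsIndepSet S)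
    (hc : Fintype.card V ≤ 2 * #S + 2) : G.IsMaximumIndepSet S := by
  refine ⟨hS, fun T hT => ?_⟩
  rcases T.eq_empty_or_nonempty with rfl | hne
  · simp
  · have := hG.two_mul_card_lt hne hT
    omega

theorem Expanding.exists_adj (hG : Expanding G) (v : V) : ∃ w, G.Adj v w := by
  have := hG {v} (singleton_nonempty v) (by simp)
  obtain ⟨w, hw⟩ := card_pos.1 (by omega : 0 < #(nbrIn G univ {v}))
  obtain ⟨-, z, hz, h⟩ := mem_nbrIn.1 hw
  rw [mem_singleton] at hz
  exact ⟨w, hz ▸ h⟩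

/-- A bipartite piece with surplus one is rigid: a 2-coloring of it is constant on the big side. -/
theorem Expanding.eq_of_surplus_one (hG : Expanding G) {B P : Finset V} (hB : G.IsIndepSet B)
    (hN : ∀ b ∈ B, ∀ p, G.Adj b p → p ∈ P) (hc : #P ≤ #B + 1) (f : V → Bool)
    (hf : ∀ b ∈ B, ∀ p ∈ P, G.Adj b p → f b ≠ f p) {p p' : V} (hp : p ∈ P) (hp' : p' ∈ P) :
    f p = f p' := by
  -- Each color occurring on `P` has surplus at least one over the opposite color class of `B`; two
  -- occurring colors would give total surplus two.
  have key : ∀ i : Bool, (∃ p ∈ P, f p = i) → #{b ∈ B | f b = !i} < #{p ∈ P | f p = i} := by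
    rintro i ⟨q, hq, hqi⟩
    rcases ({b ∈ B | f b = !i}).eq_empty_or_nonempty with he | hne
    · rw [he, card_empty]
      exact card_pos.2 ⟨q, by simp [hq, hqi]⟩
    · refine hG.card_lt hne (hB.mono (coe_subset.2 (filter_subset _ _))) fun a ha b hab => ?_
      rw [mem_filter] at ha ⊢
      have h1 := hN a ha.1 b hab
      have h2 := hf a ha.1 b h1 hab
      rw [ha.2] at h2
      exact ⟨h1, by revert h2; cases i <;> cases f b <;> simp⟩
  by_contra hne
  have h1 := key (f p) ⟨p, hp, rfl⟩
  have h2 := key (f p') ⟨p', hp', rfl⟩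
  have e : f p' = !f p := by revert hne; cases f p <;> cases f p' <;> simp
  have h3 := card_filter_add_card_filter_not (s := B) (fun b => f b = !f p)
  have h4 := card_filter_add_card_filter_not (s := P) (fun b => f b = f p)
  have e1 : ({b ∈ B | ¬ f b = !f p}) = {b ∈ B | f b = !f p'} := by
    refine filter_congr fun b _ => ?_
    rw [e]; cases f b <;> cases f p <;> simp
  have e2 : ({b ∈ P | ¬ f b = f p}) = {b ∈ P | f b = f p'} := by
    refine filter_congr fun b _ => ?_
    rw [e]; cases f b <;> cases f p <;> simp
  rw [e1] at h3
  rw [e2] at h4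
  omega

/-- If `x` lies on all odd cycles, `G - x` splits into two maximum independent sets of `G`. -/
theorem Expanding.exists_bipartition (hG : Expanding G) {x : V}
    (hx : ∀ C ∈ oddCycles G, x ∈ C.verts) :
    ∃ X Y : Finset V, x ∉ X ∧ x ∉ Y ∧ Disjoint X Y ∧ (∀ v, v ≠ x → v ∈ X ∨ v ∈ Y) ∧
      G.IsMaximumIndepSet X ∧ G.IsMaximumIndepSet Y := by
  obtain ⟨g, hg⟩ := exists_twoColoring (G := G) (fun a b => a ≠ x ∧ b ≠ x)
    (fun a b h => ⟨h.2, h.1⟩) fun C hC => by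
      obtain ⟨b, hb⟩ := exists_adj_of_mem_verts hC (hx C hC)
      exact ⟨x, b, hb, by simp⟩
  let Z : Bool → Finset V := fun i => {v | v ≠ x ∧ g v = i}
  have hZ : ∀ i v, v ∈ Z i ↔ v ≠ x ∧ g v = i := by simp [Z]
  have hind : ∀ i, G.IsIndepSet (Z i) := fun i => isIndepSet_iff_forall.2 fun a ha b hb hab => by
    rw [hZ] at ha hb
    exact hg a b hab ⟨ha.1, hb.1⟩ (ha.2.trans hb.2.symm)
  -- The neighbors of one side lie in the other side together with `x`; strict expansion pays for
  -- `x`.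
  have hle : ∀ i, #(Z i) ≤ #(Z !i) := fun i => by
    rcases (Z i).eq_empty_or_nonempty with he | hne
    · simp [he]
    · have := hG.card_lt (W := insert x (Z !i)) hne (hind i) fun a ha b hab => by
        rw [mem_insert, hZ]
        rw [hZ] at ha
        by_cases hbx : b = x
        · exact Or.inl hbx
        · have := hg a b hab ⟨ha.1, hbx⟩
          rw [ha.2] at this
          exact Or.inr ⟨hbx, by revert this; cases i <;> cases g b <;> simp⟩
      rw [card_insert_of_notMem (by simp [hZ])] at this
      omega
  have hdisj : Disjoint (Z true) (Z false) := by
    rw [Finset.disjoint_left]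
    intro a ha hb
    rw [hZ] at ha hb
    simp [ha.2] at hb
  have hcard : #(Z true) + #(Z false) + 1 = Fintype.card V := by
    have hu : Z true ∪ Z false = univ.erase x := by
      ext v
      rw [mem_union, hZ, hZ, mem_erase]
      cases g v <;> simp
    rw [← card_union_of_disjoint hdisj, hu, card_erase_of_mem (mem_univ x), card_univ]
    have := Fintype.card_pos_iff.2 ⟨x⟩
    omega
  have h1 := hle true
  have h2 := hle false
  simp only [Bool.not_true, Bool.not_false] at h1 h2
  refine ⟨Z true, Z false, by simp [hZ], by simp [hZ], hdisj, fun v hv => ?_,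
    hG.isMaximumIndepSet (hind _) (by omega), hG.isMaximumIndepSet (hind _) (by omega)⟩
  rw [hZ, hZ]
  cases g v <;> simp [hv]

theorem Expanding.mem_corona_of_ne (hG : Expanding G) {x v : V}
    (hx : ∀ C ∈ oddCycles G, x ∈ C.verts) (hv : v ≠ x) : v ∈ corona G := by
  obtain ⟨X, Y, -, -, -, hXY, hX, hY⟩ := hG.exists_bipartition hx
  rcases hXY v hv with h | h
  · exact ⟨X, hX, h⟩
  · exact ⟨Y, hY, h⟩

theorem Expanding.core_eq_empty (hG : Expanding G) {x : V}
    (hx : ∀ C ∈ oddCycles G, x ∈ C.verts) : core G = ∅ := by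
  obtain ⟨X, Y, -, -, hd, -, hX, hY⟩ := hG.exists_bipartition hx
  rw [Set.eq_empty_iff_forall_notMem]
  exact fun v hv => Finset.disjoint_left.1 hd (hv X hX) (hv Y hY)

/-- If all odd cycles are among `C₁`, `C₂` and these share exactly the vertex `x`, then `x` lies
in no maximum independent set. -/
theorem Expanding.notMem_corona (hG : Expanding G) {C₁ C₂ : G.Subgraph}
    (h₁ : C₁ ∈ oddCycles G) (h₂ : C₂ ∈ oddCycles G)
    (hC : ∀ C ∈ oddCycles G, C = C₁ ∨ C = C₂) {x : V} (hx : C₁.verts ∩ C₂.verts = {x}) :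
    x ∉ corona G := by
  rintro ⟨S, hS, hxS⟩
  have hxm : x ∈ C₁.verts ∩ C₂.verts := hx ▸ rfl
  have hxall : ∀ C ∈ oddCycles G, x ∈ C.verts := fun C h => by
    rcases hC C h with rfl | rfl
    exacts [hxm.1, hxm.2]
  obtain ⟨X, Y, hxX, hxY, hd, hXY, hX, hY⟩ := hG.exists_bipartition hxall
  have iX := isIndepSet_iff_forall.1 hX.1
  have iY := isIndepSet_iff_forall.1 hY.1
  have iS := isIndepSet_iff_forall.1 hS.1
  have hd' := Finset.disjoint_left.1 hd
  have hXYc : #X = #Y := le_antisymm (hY.2 X hX.1) (hX.2 Y hY.1)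
  have hSc : #S = #X := le_antisymm (hX.2 S hS.1) (hS.2 X hX.1)
  have hsum : #(S ∩ X) + #(S ∩ Y) + 1 = #S := by
    have hu : S.erase x = (S ∩ X) ∪ (S ∩ Y) := by
      ext v
      have := hXY v
      simp only [mem_erase, mem_union, mem_inter]
      grind
    rw [← card_union_of_disjoint (hd.mono inter_subset_right inter_subset_right), ← hu,
      card_erase_of_mem hxS]
    have := card_pos.2 ⟨x, hxS⟩
    omega
  have hXS : #(X \ S) = #(S ∩ Y) + 1 := by
    have := card_sdiff_add_card_inter X S
    rw [inter_comm X S] at this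
    omega
  have hYS : #(Y \ S) = #(S ∩ X) + 1 := by
    have := card_sdiff_add_card_inter Y S
    rw [inter_comm Y S] at this
    omega
  -- Without such an edge the complement of `S` would be independent, and membership in `S` would
  -- properly 2-color `C₁`.
  obtain ⟨u, hu, w, hw, huw⟩ : ∃ u ∈ X \ S, ∃ w ∈ Y \ S, G.Adj u w := by
    by_contra! hno
    obtain ⟨a, b, hab, he⟩ := exists_adj_eq_of_mem_oddCycles h₁ (fun v => decide (v ∈ S))
    have hab := hab.adj_sub
    have ha := hXY a
    have hb := hXY b
    simp only [decide_eq_decide] at he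
    by_cases haS : a ∈ S
    · exact iS a haS b (he.1 haS) hab
    · have hbS := mt he.2 haS
      have := hno a
      have := hno b
      have := hab.symm
      grind
  have hYX : ∀ v, v ≠ x → v ∈ Y ∨ v ∈ X := fun v hv => (hXY v hv).symm
  obtain ⟨p₁, hp₁, e₁⟩ := exists_adj_mem_of_bipartition h₁ iX iY hXY hxY
  obtain ⟨q₁, hq₁, e₁'⟩ := exists_adj_mem_of_bipartition h₁ iY iX hYX hxX
  obtain ⟨p₂, hp₂, e₂⟩ := exists_adj_mem_of_bipartition h₂ iX iY hXY hxY
  obtain ⟨q₂, hq₂, e₂'⟩ := exists_adj_mem_of_bipartition h₂ iY iX hYX hxX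
  have hsep : ∀ a b, C₁.Adj x a → C₂.Adj x b → a ≠ b := by
    rintro a _ ha hb rfl
    have : a ∈ C₁.verts ∩ C₂.verts := ⟨ha.snd_mem, hb.snd_mem⟩
    rw [hx] at this
    exact ha.adj_sub.ne this.symm
  -- Delete the edge from `x` into `X` on one cycle and into `Y` on the other. The kept edges `xp₂`
  -- and `xq₁` force `p₂` and `q₁` to share a color, while rigidity transfers the distinct colors of
  -- `u` and `w` to them.
  obtain ⟨f, hf⟩ := exists_twoColoring (G := G)
    (fun a b => s(a, b) ≠ s(x, p₁) ∧ s(a, b) ≠ s(x, q₂))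
    (fun a b h => by rwa [Sym2.eq_swap]) fun C h => by
      rcases hC C h with rfl | rfl
      · exact ⟨x, p₁, e₁, by simp⟩
      · exact ⟨x, q₂, e₂', by simp⟩
  have hf' : ∀ a b, G.Adj a b → a ≠ x → b ≠ x → f a ≠ f b := fun a b hab ha hb =>
    hf a b hab (by constructor <;> · rw [Ne, Sym2.eq_iff]; grind)
  have hp₂S : p₂ ∈ X \ S := mem_sdiff.2 ⟨hp₂, fun h => iS x hxS p₂ h e₂.adj_sub⟩
  have hq₁S : q₁ ∈ Y \ S := mem_sdiff.2 ⟨hq₁, fun h => iS x hxS q₁ h e₁'.adj_sub⟩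
  have cX : f p₂ = f u := by
    refine hG.eq_of_surplus_one (B := S ∩ Y) (P := X \ S) (hS.1.mono (by simp)) ?_ hXS.le f ?_
      hp₂S hu
    · intro b hb p hbp
      have := hXY p
      grind
    · intro b hb p hp hbp
      exact hf' b p hbp (by grind) (by grind)
  have cY : f q₁ = f w := by
    refine hG.eq_of_surplus_one (B := S ∩ X) (P := Y \ S) (hS.1.mono (by simp)) ?_ hYS.le f ?_
      hq₁S hw
    · intro b hb p hbp
      have := hXY p
      grind
    · intro b hb p hp hbp
      exact hf' b p hbp (by grind) (by grind)
  have n1 := hf' u w huw (by grind) (by grind)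
  have n2 := hf x p₂ e₂.adj_sub (by
    have := hsep p₁ p₂ e₁ e₂
    constructor <;> · rw [Ne, Sym2.eq_iff]; grind)
  have n3 := hf x q₁ e₁'.adj_sub (by
    have := hsep q₁ q₂ e₁' e₂'
    constructor <;> · rw [Ne, Sym2.eq_iff]; grind)
  rw [← cX, ← cY] at n1
  revert n1 n2 n3
  cases f x <;> cases f p₂ <;> cases f q₁ <;> simp

end Expanding

/-! ### Two disjoint odd cycles in an expanding graph -/

section DisjointOddCycles

variable {V : Type*} {G : SimpleGraph V}

open SimpleGraph Finset
open scoped Classical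

theorem mem_nbhd {S : Set V} {v : V} : v ∈ nbhd G S ↔ ∃ a ∈ S, G.Adj a v := by
  simp [nbhd]

theorem exists_adj_notMem_of_mem_oddCycles {S : Finset V} (hS : G.IsIndepSet S) {C : G.Subgraph}
    (hC : C ∈ oddCycles G) : ∃ a b, C.Adj a b ∧ a ∉ S ∧ b ∉ S := by
  obtain ⟨a, b, hab, he⟩ := exists_adj_eq_of_mem_oddCycles hC (fun v => decide (v ∈ S))
  simp only [decide_eq_decide] at he
  have ha : a ∉ S := fun ha => isIndepSet_iff_forall.1 hS a ha b (he.1 ha) hab.adj_sub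
  exact ⟨a, b, hab, ha, mt he.2 ha⟩

theorem exists_mem_verts_ne {C : G.Subgraph} (hC : C ∈ oddCycles G) (v : V) :
    ∃ c ∈ C.verts, c ≠ v := by
  obtain ⟨a, b, hab, -⟩ := exists_adj_eq_of_mem_oddCycles hC fun _ => true
  by_cases h : a = v
  · exact ⟨b, hab.snd_mem, fun hb => hab.adj_sub.ne (h.trans hb.symm)⟩
  · exact ⟨a, hab.fst_mem, h⟩

theorem eq_or_eq_of_encard_le_two {α : Type*} {s : Set α} (hs : s.encard ≤ 2) {a b : α}
    (ha : a ∈ s) (hb : b ∈ s) (hab : a ≠ b) {c : α} (hc : c ∈ s) : c = a ∨ c = b := by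
  have heq := (Set.toFinite {a, b}).eq_of_subset_of_encard_le (Set.pair_subset ha hb)
    (by rwa [Set.encard_pair hab])
  rw [← heq] at hc
  simpa using hc

variable [Fintype V]

/-! ### An independent set `S` whose complement has one vertex more than `S` -/

section NearlyHalf

variable {S : Finset V}

/-- The vertices of `S` not adjacent to `Z` have all their neighbors in `Sᶜ \ Z`; their expansion
gives Hall's inequality, the surplus of one being absorbed by strictness. -/
theorem Expanding.card_le_card_nbrIn (hG : Expanding G) (hS : G.IsIndepSet S)
    (hc : Fintype.card V = 2 * #S + 1) {Z : Finset V} (hZ : Z ⊆ Sᶜ) (hne : Z ≠ Sᶜ) :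
    #Z ≤ #(nbrIn G S Z) := by
  have hQ : #Sᶜ = #S + 1 := by rw [card_compl]; omega
  have hlt : #Z < #Sᶜ := card_lt_card (hZ.ssubset_of_ne hne)
  have hsub : nbrIn G S Z ⊆ S := filter_subset _ _
  have h1 := card_sdiff_add_card_eq_card hsub
  rcases (S \ nbrIn G S Z).eq_empty_or_nonempty with he | hI
  · rw [he, card_empty] at h1
    omega
  · have h2 := hG.card_lt (W := Sᶜ \ Z) hI (hS.mono (coe_subset.2 sdiff_subset)) fun a ha b hab => by
      rw [mem_sdiff] at ha
      rw [mem_sdiff, mem_compl]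
      exact ⟨fun hb => isIndepSet_iff_forall.1 hS a ha.1 b hb hab,
        fun hb => ha.2 (mem_nbrIn.2 ⟨ha.1, b, hb, hab.symm⟩)⟩
    have h3 := card_sdiff_add_card_eq_card hZ
    omega

/-- Exchanging the neighbors of `T` in `S` for `T` itself keeps independence and does not lower the
size. -/
theorem Expanding.mem_corona_of_tight (hG : Expanding G) (hS : G.IsIndepSet S)
    (hc : Fintype.card V = 2 * #S + 1) {T : Finset V} (hT : T ⊆ Sᶜ) (hi : G.IsIndepSet T)
    (ht : #(nbrIn G S T) ≤ #T) {q : V} (hq : q ∈ T) : q ∈ corona G := by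
  have hsub : nbrIn G S T ⊆ S := filter_subset _ _
  have hd : Disjoint T (S \ nbrIn G S T) :=
    Finset.disjoint_left.2 fun a ha hb => mem_compl.1 (hT ha) (mem_sdiff.1 hb).1
  have h1 := card_sdiff_add_card_eq_card hsub
  have h2 := card_union_of_disjoint hd
  have iS := isIndepSet_iff_forall.1 hS
  have iT := isIndepSet_iff_forall.1 hi
  refine ⟨T ∪ (S \ nbrIn G S T), hG.isMaximumIndepSet (isIndepSet_iff_forall.2 ?_) (by omega),
    mem_union_left _ hq⟩
  intro a ha b hb hab
  rw [mem_union, mem_sdiff, mem_nbrIn] at ha hb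
  rcases ha with ha | ⟨ha, ha'⟩ <;> rcases hb with hb | ⟨hb, hb'⟩
  · exact iT a ha b hb hab
  · exact hb' ⟨hb, a, ha, hab⟩
  · exact ha' ⟨ha, b, hb, hab.symm⟩
  · exact iS a ha b hb hab

/-- Expansion requires more neighbors than a tight set has inside `S`. -/
theorem Expanding.exists_adj_compl_of_tight (hG : Expanding G) {T : Finset V}
    (hi : G.IsIndepSet T) (ht : #(nbrIn G S T) ≤ #T) (hne : T.Nonempty) :
    ∃ a ∈ T, ∃ b ∉ S, G.Adj a b := by
  by_contra! hno
  refine absurd (hG.card_lt hne hi fun a ha b hab => ?_) ht.not_gt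
  exact mem_nbrIn.2 ⟨by_contra fun hb => hno a ha b hb hab, a, ha, hab⟩

/-- Each edge outside `S` is the only such edge of some odd cycle. -/
theorem Expanding.exists_oddCycle_of_adj (hG : Expanding G) (hS : G.IsIndepSet S)
    (hc : Fintype.card V = 2 * #S + 1) {a b : V} (ha : a ∉ S) (hb : b ∉ S) (hab : G.Adj a b) :
    ∃ C ∈ oddCycles G, ∀ c d, C.Adj c d → c ∉ S → d ∉ S → s(c, d) = s(a, b) := by
  by_contra! hno
  obtain ⟨f, hf⟩ := exists_twoColoring (G := G)
    (fun c d => c ∈ S ∨ d ∈ S ∨ s(c, d) = s(a, b))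
    (fun c d h => by rw [Sym2.eq_swap]; tauto) fun C hC => by
      obtain ⟨c, d, h1, h2, h3, h4⟩ := hno C hC
      exact ⟨c, d, h1, by tauto⟩
  refine hf a b hab (Or.inr (Or.inr rfl)) ?_
  -- All edges at `S` are kept, so rigidity makes the coloring constant off `S`, contradicting the
  -- kept edge `ab`.
  refine hG.eq_of_surplus_one (P := Sᶜ) hS (fun c hcS d hcd => mem_compl.2 fun hd =>
    isIndepSet_iff_forall.1 hS c hcS d hd hcd) (by rw [card_compl]; omega) f
    (fun c hcS d _ hcd => hf c d hcd (Or.inl hcS)) (mem_compl.2 ha) (mem_compl.2 hb)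

/-- Let `U` be the union of all tight independent sets. It is tight and avoids `v`. Each neighbor
`s` of `v` in `S` is missed by some maximum independent set `S'`, and `S' \ S` is tight with
neighborhood `S \ S'`. So adding `v` to `U` gives no new neighbors, and Hall's inequality fails
unless `U ∪ {v}` is all of `Sᶜ`. -/
theorem Expanding.exists_tight_of_notMem (hG : Expanding G) (hS : G.IsIndepSet S)
    (hc : Fintype.card V = 2 * #S + 1) {v : V} (hv : v ∉ corona G)
    (hv' : v ∉ nbhd G (core G)) {q : V} (hq : q ∉ S) (hqv : q ≠ v) :
    ∃ T ⊆ Sᶜ, G.IsIndepSet T ∧ #(nbrIn G S T) ≤ #T ∧ q ∈ T := by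
  have hSmax : G.IsMaximumIndepSet S := hG.isMaximumIndepSet hS (by omega)
  have hvS : v ∉ S := fun h => hv ⟨S, hSmax, h⟩
  have hall : ∀ Y ⊆ Sᶜ.erase v, #Y ≤ #(nbrIn G S Y) := fun Y hY =>
    hG.card_le_card_nbrIn hS hc (hY.trans (erase_subset _ _)) fun h =>
      notMem_erase v Sᶜ (hY (h ▸ mem_compl.2 hvS))
  let F : Finset (Finset V) := {T ∈ Sᶜ.powerset | G.IsIndepSet T ∧ #(nbrIn G S T) ≤ #T}
  have hF : ∀ T, T ∈ F ↔ T ⊆ Sᶜ ∧ G.IsIndepSet T ∧ #(nbrIn G S T) ≤ #T := by simp [F]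
  obtain ⟨hsub, ht⟩ := tight_biUnion hall F fun Z hZ => by
    obtain ⟨h1, h2, h3⟩ := (hF Z).1 hZ
    exact ⟨subset_erase.2 ⟨h1, fun h => hv (hG.mem_corona_of_tight hS hc h1 h2 h3 h)⟩, h3⟩
  have hins : insert v (F.biUnion id) = Sᶜ := by
    by_contra hne
    have hvT : v ∉ F.biUnion id := fun h => notMem_erase v Sᶜ (hsub h)
    have h1 := hG.card_le_card_nbrIn hS hc (insert_subset (mem_compl.2 hvS)
      (hsub.trans (erase_subset _ _))) hne
    rw [card_insert_of_notMem hvT] at h1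
    have h2 : nbrIn G S (insert v (F.biUnion id)) ⊆ nbrIn G S (F.biUnion id) := by
      intro s hs
      obtain ⟨hsS, z, hz, hzs⟩ := mem_nbrIn.1 hs
      rcases mem_insert.1 hz with rfl | hz
      · have hcore : s ∉ core G := fun h => hv' (mem_nbhd.2 ⟨s, h, hzs.symm⟩)
        simp only [core, Set.mem_ofPred_eq, not_forall] at hcore
        obtain ⟨S', hS', hsS'⟩ := hcore
        have hTS : S' \ S ⊆ Sᶜ.erase z := fun t ht => by
          rw [mem_sdiff] at ht
          exact mem_erase.2 ⟨fun h => hv ⟨S', hS', h ▸ ht.1⟩, mem_compl.2 ht.2⟩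
        have hsub' : nbrIn G S (S' \ S) ⊆ S \ S' := fun t ht => by
          obtain ⟨h1, y, hy, h2⟩ := mem_nbrIn.1 ht
          exact mem_sdiff.2 ⟨h1, fun h =>
            isIndepSet_iff_forall.1 hS'.1 y (mem_sdiff.1 hy).1 t h h2⟩
        have hcard : #(S \ S') = #(S' \ S) := by
          have e := le_antisymm (hSmax.2 S' hS'.1) (hS'.2 S hS)
          have e1 := card_sdiff_add_card_inter S S'
          have e2 := card_sdiff_add_card_inter S' S
          rw [inter_comm] at e2
          omega
        have heq := eq_of_subset_of_card_le hsub' (hcard.trans_le (hall _ hTS))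
        refine nbrIn_mono (subset_biUnion_of_mem id ((hF (S' \ S)).2 ⟨hTS.trans (erase_subset _ _),
          hS'.1.mono (coe_subset.2 sdiff_subset), ?_⟩)) ?_
        · rw [heq, hcard]
        · change s ∈ nbrIn G S (S' \ S)
          rw [heq]
          exact mem_sdiff.2 ⟨hsS, hsS'⟩
      · exact mem_nbrIn.2 ⟨hsS, z, hz, hzs⟩
    have h3 := card_le_card h2
    omega
  have hqm : q ∈ insert v (F.biUnion id) := hins ▸ mem_compl.2 hq
  obtain ⟨T, hT, hqT⟩ := mem_biUnion.1 ((mem_insert.1 hqm).resolve_left hqv)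
  obtain ⟨h1, h2, h3⟩ := (hF T).1 hT
  exact ⟨T, h1, h2, h3, hqT⟩

/-- A vertex of `S` on the first of two disjoint odd cycles splits the complement of `S` into
tight parts, one of which avoids the edge `u₂v₂` and one end of `u₁v₁`. -/
theorem Expanding.exists_tight_separation (hG : Expanding G) (hS : G.IsIndepSet S)
    (hc : Fintype.card V = 2 * #S + 1) {C₁ C₂ : G.Subgraph} (h₂ : C₂ ∈ oddCycles G)
    (h₁ : C₁ ∈ oddCycles G)
    (hC : ∀ C ∈ oddCycles G, C = C₁ ∨ C = C₂) (hd : Disjoint C₁.verts C₂.verts)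
    {u₁ v₁ u₂ v₂ : V} (e₁ : C₁.Adj u₁ v₁) (e₂ : C₂.Adj u₂ v₂) (hu₁ : u₁ ∉ S) (hv₁ : v₁ ∉ S)
    (hu₂ : u₂ ∉ S) (hv₂ : v₂ ∉ S) {s : V} (hs : s ∈ S) (hsC : s ∈ C₁.verts) :
    ∃ Z ⊆ Sᶜ, #(nbrIn G S Z) ≤ #Z ∧ s ∈ nbrIn G S Z ∧ u₂ ∉ Z ∧ v₂ ∉ Z ∧ ¬ (u₁ ∈ Z ∧ v₁ ∈ Z) := by
  have hd' := Set.disjoint_left.1 hd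
  -- Removing `s` destroys `C₁`, and removing the edge `u₂v₂` destroys `C₂`. Then `u₁`, `v₁` get
  -- different colors, but `u₂`, `v₂` the same one.
  obtain ⟨f, hf⟩ := exists_twoColoring (G := G)
    (fun a b => a ≠ s ∧ b ≠ s ∧ s(a, b) ≠ s(u₂, v₂))
    (fun a b h => by rw [Sym2.eq_swap]; tauto) fun C h => by
      rcases hC C h with rfl | rfl
      · obtain ⟨b, hb⟩ := exists_adj_of_mem_verts h₁ hsC
        exact ⟨s, b, hb, by simp⟩
      · exact ⟨u₂, v₂, e₂, by simp⟩
  have hne : ∀ {a}, a ∉ S → a ≠ s := fun ha h => ha (h ▸ hs)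
  have hf₁ : f u₁ ≠ f v₁ := by
    refine hf u₁ v₁ e₁.adj_sub ⟨hne hu₁, hne hv₁, fun h => ?_⟩
    rcases Sym2.eq_iff.1 h with ⟨h, -⟩ | ⟨h, -⟩
    · exact hd' e₁.fst_mem (h ▸ e₂.fst_mem)
    · exact hd' e₁.fst_mem (h ▸ e₂.snd_mem)
  have hf₂ : f u₂ = f v₂ := by
    by_contra hn
    obtain ⟨a, b, hab, he⟩ := exists_adj_eq_of_mem_oddCycles h₂ f
    refine hf a b hab.adj_sub ⟨fun h => hd' hsC (h ▸ hab.fst_mem),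
      fun h => hd' hsC (h ▸ hab.snd_mem), fun h => ?_⟩ he
    rcases Sym2.eq_iff.1 h with ⟨rfl, rfl⟩ | ⟨rfl, rfl⟩
    · exact hn he
    · exact hn he.symm
  let Z : Bool → Finset V := fun i => {q ∈ Sᶜ | f q = i}
  let W : Bool → Finset V := fun i => {t ∈ S.erase s | f t = !i}
  have hZ : ∀ i q, q ∈ Z i ↔ q ∉ S ∧ f q = i := by simp [Z]
  have hW : ∀ i t, t ∈ W i ↔ (t ≠ s ∧ t ∈ S) ∧ f t = !i := by simp [W]
  have hWZ : ∀ i, #(W i) < #(Z i) := fun i => by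
    rcases (W i).eq_empty_or_nonempty with he | hn
    · rw [he, card_empty, card_pos]
      by_cases h : f u₁ = i
      · exact ⟨u₁, (hZ _ _).2 ⟨hu₁, h⟩⟩
      · refine ⟨v₁, (hZ _ _).2 ⟨hv₁, ?_⟩⟩
        revert h hf₁
        cases i <;> cases f u₁ <;> cases f v₁ <;> simp
    · refine hG.card_lt hn (hS.mono fun a ha => ((hW i a).1 ha).1.2) fun a ha b hab => ?_
      obtain ⟨⟨h1, h2⟩, h3⟩ := (hW i a).1 ha
      have hb : b ∉ S := fun hb => isIndepSet_iff_forall.1 hS a h2 b hb hab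
      have := hf a b hab ⟨h1, hne hb, fun h => by
        rcases Sym2.eq_iff.1 h with ⟨rfl, -⟩ | ⟨rfl, -⟩
        · exact hu₂ h2
        · exact hv₂ h2⟩
      rw [h3] at this
      exact (hZ i b).2 ⟨hb, by revert this; cases i <;> cases f b <;> simp⟩
  have hZs : ∀ i, #(Z i) + #(Z !i) = #S + 1 := fun i => by
    have h := card_filter_add_card_filter_not (s := Sᶜ) (fun b => f b = i)
    have e : ({b ∈ Sᶜ | ¬ f b = i}) = Z !i :=
      filter_congr fun b _ => by cases f b <;> cases i <;> simp
    rw [e, card_compl] at h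
    change #(Z i) + _ = _ at h
    omega
  have hWs : ∀ i, #(W i) + #(W !i) + 1 = #S := fun i => by
    have h := card_filter_add_card_filter_not (s := S.erase s) (fun b => f b = !i)
    have e : ({b ∈ S.erase s | ¬ f b = !i}) = W !i :=
      filter_congr fun b _ => by cases f b <;> cases i <;> simp
    rw [e, card_erase_of_mem hs] at h
    change #(W i) + _ = _ at h
    have := card_pos.2 ⟨s, hs⟩
    omega
  have hsub : ∀ i, nbrIn G S (Z i) ⊆ insert s (W i) := fun i t ht => by
    obtain ⟨htS, z, hz, hzt⟩ := mem_nbrIn.1 ht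
    obtain ⟨hz1, hz2⟩ := (hZ i z).1 hz
    rw [mem_insert]
    by_cases hts : t = s
    · exact Or.inl hts
    · have := hf z t hzt ⟨hne hz1, hts, fun h => by
        rcases Sym2.eq_iff.1 h with ⟨-, rfl⟩ | ⟨-, rfl⟩
        · exact hv₂ htS
        · exact hu₂ htS⟩
      rw [hz2] at this
      exact Or.inr ((hW i t).2 ⟨⟨hts, htS⟩, by revert this; cases i <;> cases f t <;> simp⟩)
  have hins : ∀ i, #(insert s (W i)) = #(W i) + 1 := fun i =>
    card_insert_of_notMem fun h => ((hW i s).1 h).1.1 rfl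
  -- Expansion and the totals force each `Z i` to exceed `W i` by exactly one. For the color
  -- avoiding `u₂` and `v₂`, Hall's inequality then makes the neighborhood all of `W i ∪ {s}`.
  let i := !f u₂
  have hnu : u₂ ∉ Z i := fun h => by simpa [i] using ((hZ _ _).1 h).2
  have hnv : v₂ ∉ Z i := fun h => by simpa [i, hf₂] using ((hZ _ _).1 h).2
  have hZS : Z i ⊆ Sᶜ := filter_subset _ _
  have hhall := hG.card_le_card_nbrIn hS hc hZS fun h => hnu (h ▸ mem_compl.2 hu₂)
  have c1 := hWZ i
  have c2 := hWZ !i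
  have c3 := hZs i
  have c4 := hWs i
  have c5 := hins i
  have c6 := card_le_card (hsub i)
  have heq := eq_of_subset_of_card_le (hsub i) (by omega)
  refine ⟨Z i, hZS, by omega, heq ▸ mem_insert_self _ _, hnu, hnv, fun h => hf₁ ?_⟩
  rw [((hZ _ _).1 h.1).2, ((hZ _ _).1 h.2).2]

/-- Attach a tight independent set to each vertex of `C₁`: one having it in its neighborhood for
vertices of `S`, one containing it otherwise. Coloring by whether this set contains `u₁`, with the
answer flipped off `S`, is proper on `C₁`, although `C₁` is odd. -/
theorem Expanding.false_of_notMem_verts (hG : Expanding G) (hS : G.IsIndepSet S)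
    (hc : Fintype.card V = 2 * #S + 1) {C₁ C₂ : G.Subgraph} (h₁ : C₁ ∈ oddCycles G)
    (h₂ : C₂ ∈ oddCycles G)
    (hC : ∀ C ∈ oddCycles G, C = C₁ ∨ C = C₂) (hd : Disjoint C₁.verts C₂.verts) {v : V}
    (hv : v ∉ corona G) (hv' : v ∉ nbhd G (core G)) (hvC : v ∉ C₁.verts) : False := by
  have hd' := Set.disjoint_left.1 hd
  have hSmax : G.IsMaximumIndepSet S := hG.isMaximumIndepSet hS (by omega)
  have hvS : v ∉ S := fun h => hv ⟨S, hSmax, h⟩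
  obtain ⟨u₁, v₁, e₁, hu₁, hv₁⟩ := exists_adj_notMem_of_mem_oddCycles hS h₁
  obtain ⟨u₂, v₂, e₂, hu₂, hv₂⟩ := exists_adj_notMem_of_mem_oddCycles hS h₂
  have hedge : ∀ a b, G.Adj a b → a ∉ S → b ∉ S → s(a, b) = s(u₁, v₁) ∨ s(a, b) = s(u₂, v₂) := by
    intro a b hab ha hb
    obtain ⟨C, hCo, h⟩ := hG.exists_oddCycle_of_adj hS hc ha hb hab
    rcases hC C hCo with rfl | rfl
    · exact Or.inl (h _ _ e₁ hu₁ hv₁).symm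
    · exact Or.inr (h _ _ e₂ hu₂ hv₂).symm
  have hmem : ∀ {T : Finset V}, T ⊆ Sᶜ → G.IsIndepSet T → #(nbrIn G S T) ≤ #T → v ∉ T :=
    fun h1 h2 h3 h => hv (hG.mem_corona_of_tight hS hc h1 h2 h3 h)
  -- The empty set is a dummy value at `v` and at vertices of `S` off `C₁`, none of which are used.
  have hW : ∀ w, ∃ W : Finset V, (w ∈ S → w ∈ C₁.verts → W ⊆ Sᶜ ∧ #(nbrIn G S W) ≤ #W ∧
      w ∈ nbrIn G S W ∧ u₂ ∉ W ∧ v₂ ∉ W ∧ ¬ (u₁ ∈ W ∧ v₁ ∈ W)) ∧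
      (w ∉ S → w ≠ v → W ⊆ Sᶜ ∧ G.IsIndepSet W ∧ #(nbrIn G S W) ≤ #W ∧ w ∈ W) := by
    intro w
    by_cases hw : w ∈ S
    · by_cases hwC : w ∈ C₁.verts
      · obtain ⟨Z, hZ⟩ := hG.exists_tight_separation hS hc h₂ h₁ hC hd e₁ e₂ hu₁ hv₁ hu₂ hv₂ hw hwC
        exact ⟨Z, fun _ _ => hZ, fun h => absurd hw h⟩
      · exact ⟨∅, fun _ h => absurd h hwC, fun h => absurd hw h⟩
    · by_cases hwv : w = v
      · exact ⟨∅, fun h => absurd h hw, fun _ h => absurd hwv h⟩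
      · obtain ⟨T, hT⟩ := hG.exists_tight_of_notMem hS hc hv hv' hw hwv
        exact ⟨T, fun h => absurd h hw, fun _ _ => hT⟩
  choose W hWS hWQ using hW
  have key : ∀ s q, G.Adj s q → s ∈ S → q ∉ S → s ∈ C₁.verts → q ≠ v →
      (u₁ ∈ W s ↔ u₁ ∈ W q) := by
    intro s q hsq hs hq hsC hqv
    obtain ⟨z1, z2, z3, z4, z5, z6⟩ := hWS s hs hsC
    obtain ⟨t1, t2, t3, t4⟩ := hWQ q hq hqv
    have hZi : G.IsIndepSet (W s) := isIndepSet_iff_forall.2 fun a ha b hb hab => by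
      rcases hedge a b hab (mem_compl.1 (z1 ha)) (mem_compl.1 (z1 hb)) with h | h <;>
      rcases Sym2.eq_iff.1 h with ⟨rfl, rfl⟩ | ⟨rfl, rfl⟩
      exacts [z6 ⟨ha, hb⟩, z6 ⟨hb, ha⟩, z4 ha, z4 hb]
    have hvu : v ∉ W s ∪ W q := by
      rw [mem_union, not_or]
      exact ⟨hmem z1 hZi z2, hmem t1 t2 t3⟩
    obtain ⟨-, h2, h3⟩ := tight_union_inter (fun Y hY => hG.card_le_card_nbrIn hS hc
      (hY.trans (union_subset z1 t1)) fun h => hvu (hY (h ▸ mem_compl.2 hvS))) z2 t3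
    have hsm : s ∈ nbrIn G S (W s ∩ W q) := by
      rw [h3, mem_inter]
      exact ⟨z3, mem_nbrIn.2 ⟨hs, q, t4, hsq.symm⟩⟩
    obtain ⟨-, z, hz, -⟩ := mem_nbrIn.1 hsm
    -- The intersection is nonempty and tight, so an edge off `S` starts in it, necessarily `u₁v₁`.
    -- Both sets thus share `u₁` or share `v₁`, and neither contains both ends.
    obtain ⟨a, ha, b, hb, hab⟩ := hG.exists_adj_compl_of_tight
      (hZi.mono (coe_subset.2 inter_subset_left)) h2 ⟨z, hz⟩
    rw [mem_inter] at ha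
    have hT : ¬ (u₁ ∈ W q ∧ v₁ ∈ W q) := fun h =>
      isIndepSet_iff_forall.1 t2 u₁ h.1 v₁ h.2 e₁.adj_sub
    rcases hedge a b hab (mem_compl.1 (z1 ha.1)) hb with h | h <;>
      rcases Sym2.eq_iff.1 h with ⟨rfl, rfl⟩ | ⟨rfl, rfl⟩ <;> tauto
  obtain ⟨a, b, hab, he⟩ := exists_adj_eq_of_mem_oddCycles h₁
    (fun w => if w ∈ S then decide (u₁ ∈ W w) else !decide (u₁ ∈ W w))
  have hav : a ≠ v := fun h => hvC (h ▸ hab.fst_mem)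
  have hbv : b ≠ v := fun h => hvC (h ▸ hab.snd_mem)
  have hends : ¬ (u₁ ∈ W u₁ ↔ u₁ ∈ W v₁) := by
    obtain ⟨-, -, -, h⟩ := hWQ u₁ hu₁ fun h => hvC (h ▸ e₁.fst_mem)
    obtain ⟨-, h2, -, h4⟩ := hWQ v₁ hv₁ fun h => hvC (h ▸ e₁.snd_mem)
    exact fun hi => isIndepSet_iff_forall.1 h2 u₁ (hi.1 h) v₁ h4 e₁.adj_sub
  by_cases ha : a ∈ S <;> by_cases hb : b ∈ S
  · exact isIndepSet_iff_forall.1 hS a ha b hb hab.adj_sub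
  · have := key a b hab.adj_sub ha hb hab.fst_mem hbv
    simp [ha, hb, this] at he
  · have := key b a hab.adj_sub.symm hb ha hab.snd_mem hav
    simp [ha, hb, this] at he
  · simp only [ha, hb, if_false, Bool.not_inj_iff, decide_eq_decide] at he
    rcases hedge a b hab.adj_sub ha hb with h | h
    · rcases Sym2.eq_iff.1 h with ⟨rfl, rfl⟩ | ⟨rfl, rfl⟩
      · exact hends he
      · exact hends he.symm
    · rcases Sym2.eq_iff.1 h with ⟨rfl, -⟩ | ⟨rfl, -⟩
      · exact hd' hab.fst_mem e₂.fst_mem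
      · exact hd' hab.fst_mem e₂.snd_mem

end NearlyHalf

theorem Expanding.mem_corona_or_mem_nbhd_core_of_disjoint (hG : Expanding G)
    {C₁ C₂ : G.Subgraph} (h₁ : C₁ ∈ oddCycles G) (h₂ : C₂ ∈ oddCycles G)
    (hC : ∀ C ∈ oddCycles G, C = C₁ ∨ C = C₂) (hd : Disjoint C₁.verts C₂.verts) (v : V) :
    v ∈ corona G ∨ v ∈ nbhd G (core G) := by
  obtain ⟨c₁, hc₁, hv₁⟩ := exists_mem_verts_ne h₁ v
  obtain ⟨c₂, hc₂, hv₂⟩ := exists_mem_verts_ne h₂ v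
  have hcne : c₁ ≠ c₂ := fun h => Set.disjoint_left.1 hd hc₁ (h ▸ hc₂)
  obtain ⟨g, hg⟩ := exists_twoColoring (G := G)
    (fun a b => a ∉ ({c₁, c₂} : Finset V) ∧ b ∉ ({c₁, c₂} : Finset V))
    (fun a b h => ⟨h.2, h.1⟩) fun C h => by
      rcases hC C h with rfl | rfl
      · obtain ⟨b, hb⟩ := exists_adj_of_mem_verts h₁ hc₁
        exact ⟨c₁, b, hb, by simp⟩
      · obtain ⟨b, hb⟩ := exists_adj_of_mem_verts h₂ hc₂
        exact ⟨c₂, b, hb, by simp⟩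
  let Z : Bool → Finset V := fun i => {w ∈ ({c₁, c₂} : Finset V)ᶜ | g w = i}
  have hZ : ∀ i w, w ∈ Z i ↔ w ∉ ({c₁, c₂} : Finset V) ∧ g w = i := fun i w => by
    simp only [Z, mem_filter, mem_compl]
  have hind : ∀ i, G.IsIndepSet (Z i) := fun i => isIndepSet_iff_forall.2 fun a ha b hb hab => by
    rw [hZ] at ha hb
    exact hg a b hab ⟨ha.1, hb.1⟩ (ha.2.trans hb.2.symm)
  have hpos : 0 < Fintype.card V := Fintype.card_pos_iff.2 ⟨v⟩
  have hlt : ∀ i, 2 * #(Z i) < Fintype.card V := fun i => by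
    rcases (Z i).eq_empty_or_nonempty with he | hne
    · simpa [he] using hpos
    · exact hG.two_mul_card_lt hne (hind i)
  have hsum : #(Z (g v)) + #(Z !(g v)) + 2 = Fintype.card V := by
    have h := card_filter_add_card_filter_not (s := ({c₁, c₂} : Finset V)ᶜ) (fun b => g b = g v)
    have e : ({b ∈ ({c₁, c₂} : Finset V)ᶜ | ¬ g b = g v}) = Z !(g v) :=
      filter_congr fun b _ => by cases g b <;> cases g v <;> simp
    have hle := card_le_univ ({c₁, c₂} : Finset V)
    rw [e, card_compl] at h
    rw [card_pair hcne] at h hle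
    change #(Z (g v)) + _ = _ at h
    omega
  have hvZ : v ∈ Z (g v) := (hZ _ _).2 ⟨by simp [hv₁.symm, hv₂.symm], rfl⟩
  have l1 := hlt (g v)
  have l2 := hlt !(g v)
  -- If the side of `v` is not maximum by counting, the other side has exactly (|V| - 1)/2 vertices
  -- and serves as `S`.
  by_cases hmax : Fintype.card V ≤ 2 * #(Z (g v)) + 2
  · exact Or.inl ⟨_, hG.isMaximumIndepSet (hind _) hmax, hvZ⟩
  · by_contra! hno
    have hS := hind !(g v)
    have hc : Fintype.card V = 2 * #(Z !(g v)) + 1 := by omega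
    by_cases hvC : v ∈ C₁.verts
    · exact hG.false_of_notMem_verts hS hc h₂ h₁ (fun C h => (hC C h).symm) hd.symm hno.1 hno.2
        fun h => Set.disjoint_left.1 hd hvC h
    · exact hG.false_of_notMem_verts hS hc h₁ h₂ hC hd hno.1 hno.2 hvC

/-- The main equivalence for graphs in which independent sets expand. -/
theorem Expanding.forall_mem_corona_or_mem_nbhd_core_iff (hG : Expanding G)
    (hodd : (oddCycles G).encard ≤ 2) :
    (∀ v, v ∈ corona G ∨ v ∈ nbhd G (core G)) ↔ ¬ HasOddCyclesSharingOneVertex G := by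
  constructor
  · rintro h ⟨C₁, h₁, C₂, h₂, x, hx⟩
    have hne : C₁ ≠ C₂ := by
      rintro rfl
      obtain ⟨c, hc, hcx⟩ := exists_mem_verts_ne h₁ x
      rw [Set.inter_self] at hx
      exact hcx (hx ▸ hc : c ∈ ({x} : Set V))
    have hC : ∀ C ∈ oddCycles G, C = C₁ ∨ C = C₂ := fun C hC =>
      eq_or_eq_of_encard_le_two hodd h₁ h₂ hne hC
    have hxm : x ∈ C₁.verts ∩ C₂.verts := hx ▸ rfl
    have hcore := hG.core_eq_empty (x := x) fun C h => by
      rcases hC C h with rfl | rfl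
      exacts [hxm.1, hxm.2]
    rcases h x with h | h
    · exact hG.notMem_corona h₁ h₂ hC hx h
    · simp [hcore, nbhd] at h
  · intro hno v
    have two : ∀ x y : V, x ≠ y → (∀ C ∈ oddCycles G, x ∈ C.verts ∧ y ∈ C.verts) →
        v ∈ corona G := fun x y hxy h => by
      by_cases hvx : v = x
      · exact hG.mem_corona_of_ne (fun C hC => (h C hC).2) (hvx ▸ hxy)
      · exact hG.mem_corona_of_ne (fun C hC => (h C hC).1) hvx
    rcases (oddCycles G).eq_empty_or_nonempty with he | ⟨C₁, h₁⟩
    · obtain ⟨w, hw⟩ := hG.exists_adj v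
      exact Or.inl (two v w hw.ne (by simp [he]))
    obtain ⟨C₂, h₂, hC⟩ : ∃ C₂ ∈ oddCycles G, ∀ C ∈ oddCycles G, C = C₁ ∨ C = C₂ := by
      by_cases hall : ∃ C₂ ∈ oddCycles G, C₂ ≠ C₁
      · obtain ⟨C₂, h₂, hne⟩ := hall
        exact ⟨C₂, h₂, fun C hC => eq_or_eq_of_encard_le_two hodd h₁ h₂ hne.symm hC⟩
      · push Not at hall
        -- A single odd cycle is paired with itself, which lands in the case of two common vertices.
        exact ⟨C₁, h₁, fun C hC => Or.inl (hall C hC)⟩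
    rcases (C₁.verts ∩ C₂.verts).eq_empty_or_nonempty with he | ⟨x, hx⟩
    · exact hG.mem_corona_or_mem_nbhd_core_of_disjoint h₁ h₂ hC (Set.disjoint_iff_inter_eq_empty.2 he) v
    · obtain ⟨y, hy, hyx⟩ : ∃ y ∈ C₁.verts ∩ C₂.verts, y ≠ x := by
        by_contra! hall
        exact hno ⟨C₁, h₁, C₂, h₂, x, Set.eq_singleton_iff_unique_mem.2 ⟨hx, hall⟩⟩
      refine Or.inl (two x y hyx.symm fun C h => ?_)
      rcases hC C h with rfl | rfl
      exacts [⟨hx.1, hy.1⟩, ⟨hx.2, hy.2⟩]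

end DisjointOddCycles

/-! ### Reduction to the graph outside the Larson set -/

section Larson

variable {V : Type*} {G : SimpleGraph V}

open SimpleGraph Finset
open scoped Classical

/-- The union of `J` with a set of vertices outside `L`. -/
noncomputable def extendBy (J : Finset V) {L : Set V} (T : Finset ↥Lᶜ) : Finset V :=
  J ∪ T.map (Function.Embedding.subtype _)

theorem mem_extendBy {J : Finset V} {L : Set V} {T : Finset ↥Lᶜ} {v : V} :
    v ∈ extendBy J T ↔ v ∈ J ∨ ∃ h : v ∈ Lᶜ, (⟨v, h⟩ : ↥Lᶜ) ∈ T := by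
  simp [extendBy]

theorem isIndepSet_subtype {L : Set V} {S : Finset V} (hS : G.IsIndepSet S) :
    (G.induce Lᶜ).IsIndepSet (S.subtype (· ∈ Lᶜ)) :=
  isIndepSet_iff_forall.2 fun a ha b hb hab =>
    isIndepSet_iff_forall.1 hS a (mem_subtype.1 ha) b (mem_subtype.1 hb) hab

variable [Fintype V]

theorem coe_nbrIn_univ (I : Finset V) : (nbrIn G univ I : Set V) = nbhd G I := by
  ext v
  simp [mem_nbrIn, mem_nbhd]

section

variable {J : Finset V} {L : Set V}

theorem IsCriticalIndepSet.card_add_le (hJ : IsCriticalIndepSet G J) {I : Finset V}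
    (hI : G.IsIndepSet I) : #I + #(nbrIn G univ J) ≤ #J + #(nbrIn G univ I) := by
  have := hJ.2 I hI
  rw [← coe_nbrIn_univ, ← coe_nbrIn_univ] at this
  simp only [Set.ncard_coe_finset] at this
  omega

theorem IsMaximumCriticalIndepSet.card_le (hJ : IsMaximumCriticalIndepSet G J) {I : Finset V}
    (hI : G.IsIndepSet I) (h : #J + #(nbrIn G univ I) ≤ #I + #(nbrIn G univ J)) : #I ≤ #J := by
  have := hJ.2 I ⟨hI, fun K hK => ?_⟩
  · simpa only [Set.ncard_coe_finset] using this
  · have hK' := hJ.1.2 K hK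
    rw [← coe_nbrIn_univ J] at hK'
    rw [← coe_nbrIn_univ I]
    simp only [Set.ncard_coe_finset] at hK' ⊢
    omega

/-- Hall's condition from the neighborhood of a critical set into the set. -/
theorem IsCriticalIndepSet.card_le_card_nbrIn (hJ : IsCriticalIndepSet G J) {T : Finset V}
    (hT : T ⊆ nbrIn G univ J) : #T ≤ #(nbrIn G J T) := by
  have hsub : nbrIn G J T ⊆ J := filter_subset _ _
  -- Dropping the neighbors of `T` from `J` frees all of `T` from the neighborhood, so criticality
  -- bounds `T` by what was dropped.
  have h1 := hJ.card_add_le (I := J \ nbrIn G J T) (hJ.1.mono (coe_subset.2 sdiff_subset))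
  have h2 : nbrIn G univ (J \ nbrIn G J T) ⊆ nbrIn G univ J \ T := fun b hb => by
    obtain ⟨-, a, ha, hab⟩ := mem_nbrIn.1 hb
    rw [mem_sdiff] at ha ⊢
    exact ⟨mem_nbrIn.2 ⟨mem_univ _, a, ha.1, hab⟩,
      fun h => ha.2 (mem_nbrIn.2 ⟨ha.1, b, h, hab.symm⟩)⟩
  have h3 := card_le_card h2
  have h4 := card_sdiff_add_card_eq_card hsub
  have h5 := card_sdiff_add_card_eq_card hT
  omega

theorem IsCriticalIndepSet.card_inter_le (hJ : IsCriticalIndepSet G J) {S : Finset V}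
    (hS : G.IsIndepSet S) : #(S ∩ nbrIn G univ J) ≤ #(J \ S) := by
  refine (hJ.card_le_card_nbrIn inter_subset_right).trans (card_le_card fun b hb => ?_)
  obtain ⟨hbJ, a, ha, hab⟩ := mem_nbrIn.1 hb
  exact mem_sdiff.2 ⟨hbJ, fun h => isIndepSet_iff_forall.1 hS a (mem_inter.1 ha).1 b h hab⟩

theorem disjoint_nbrIn_of_isIndepSet (hJ : G.IsIndepSet J) : Disjoint J (nbrIn G univ J) := by
  refine Finset.disjoint_left.2 fun a ha hb => ?_
  obtain ⟨-, b, hb, hab⟩ := mem_nbrIn.1 hb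
  exact isIndepSet_iff_forall.1 hJ b hb a ha hab

theorem card_extendBy (hL : ∀ v, v ∈ L ↔ v ∈ J ∨ v ∈ nbrIn G univ J) (T : Finset ↥Lᶜ) :
    #(extendBy J T) = #J + #T := by
  rw [extendBy, card_union_of_disjoint, card_map]
  refine Finset.disjoint_left.2 fun a ha hb => ?_
  obtain ⟨b, -, rfl⟩ := mem_map.1 hb
  exact b.2 ((hL _).2 (Or.inl ha))

theorem isIndepSet_extendBy (hJ : G.IsIndepSet J)
    (hL : ∀ v, v ∈ L ↔ v ∈ J ∨ v ∈ nbrIn G univ J) {T : Finset ↥Lᶜ}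
    (hT : (G.induce Lᶜ).IsIndepSet T) : G.IsIndepSet (extendBy J T) := by
  have hout : ∀ a ∈ J, ∀ b ∈ Lᶜ, ¬ G.Adj a b := fun a ha b hb hab =>
    hb ((hL b).2 (Or.inr (mem_nbrIn.2 ⟨mem_univ _, a, ha, hab⟩)))
  refine isIndepSet_iff_forall.2 fun a ha b hb hab => ?_
  rcases mem_extendBy.1 ha with ha | ⟨ha, ha'⟩ <;> rcases mem_extendBy.1 hb with hb | ⟨hb, hb'⟩
  · exact isIndepSet_iff_forall.1 hJ a ha b hb hab
  · exact hout a ha b hb hab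
  · exact hout b hb a ha hab.symm
  · exact isIndepSet_iff_forall.1 hT _ ha' _ hb' hab

theorem card_eq_of_larson (hJ : G.IsIndepSet J)
    (hL : ∀ v, v ∈ L ↔ v ∈ J ∨ v ∈ nbrIn G univ J) (S : Finset V) :
    #S = #(J ∩ S) + #(S ∩ nbrIn G univ J) + #(S.subtype (· ∈ Lᶜ)) := by
  rw [card_subtype]
  have h1 := card_filter_add_card_filter_not (s := S) (· ∈ Lᶜ)
  have h2 : ({a ∈ S | ¬ a ∈ Lᶜ}) = (J ∩ S) ∪ (S ∩ nbrIn G univ J) := by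
    ext a
    simp only [mem_filter, Set.mem_compl_iff, not_not, hL, mem_union, mem_inter]
    tauto
  rw [h2, card_union_of_disjoint ((disjoint_nbrIn_of_isIndepSet hJ).mono inter_subset_left
    inter_subset_right)] at h1
  omega

/-- By Hall's condition, the vertices of `S` in N(`J`) are at most as many as the vertices of `J`
that they exclude from `S`. -/
theorem IsCriticalIndepSet.card_le_card_subtype (hJ : IsCriticalIndepSet G J)
    (hL : ∀ v, v ∈ L ↔ v ∈ J ∨ v ∈ nbrIn G univ J) {S : Finset V} (hS : G.IsIndepSet S) :
    #S ≤ #J + #(S.subtype (· ∈ Lᶜ)) := by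
  have h1 := card_eq_of_larson hJ.1 hL S
  have h2 := hJ.card_inter_le hS
  have h3 := card_sdiff_add_card_inter J S
  omega

theorem IsCriticalIndepSet.isMaximumIndepSet_extendBy (hJ : IsCriticalIndepSet G J)
    (hL : ∀ v, v ∈ L ↔ v ∈ J ∨ v ∈ nbrIn G univ J) {T : Finset ↥Lᶜ}
    (hT : (G.induce Lᶜ).IsMaximumIndepSet T) : G.IsMaximumIndepSet (extendBy J T) := by
  refine ⟨isIndepSet_extendBy hJ.1 hL hT.1, fun S hS => ?_⟩
  rw [card_extendBy hL]
  have := hT.2 _ (isIndepSet_subtype hS)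
  have := hJ.card_le_card_subtype hL hS
  omega

theorem IsCriticalIndepSet.isMaximumIndepSet_subtype (hJ : IsCriticalIndepSet G J)
    (hL : ∀ v, v ∈ L ↔ v ∈ J ∨ v ∈ nbrIn G univ J) {S : Finset V}
    (hS : G.IsMaximumIndepSet S) : (G.induce Lᶜ).IsMaximumIndepSet (S.subtype (· ∈ Lᶜ)) := by
  refine ⟨isIndepSet_subtype hS.1, fun T hT => ?_⟩
  have h1 := hS.2 _ (isIndepSet_extendBy hJ.1 hL hT)
  rw [card_extendBy hL] at h1
  have := hJ.card_le_card_subtype hL hS.1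
  omega

theorem IsCriticalIndepSet.card_sdiff_le (hJ : IsCriticalIndepSet G J)
    (hL : ∀ v, v ∈ L ↔ v ∈ J ∨ v ∈ nbrIn G univ J) {S : Finset V}
    (hS : G.IsMaximumIndepSet S) : #(J \ S) ≤ #(S ∩ nbrIn G univ J) := by
  have h1 := hS.2 _ (isIndepSet_extendBy hJ.1 hL (isIndepSet_subtype (L := L) hS.1))
  rw [card_extendBy hL] at h1
  have h2 := card_eq_of_larson hJ.1 hL S
  have h3 := card_sdiff_add_card_inter J S
  omega

/-- Independent sets expand outside the Larson set. -/
theorem IsMaximumCriticalIndepSet.expanding (hJ : IsMaximumCriticalIndepSet G J)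
    (hL : ∀ v, v ∈ L ↔ v ∈ J ∨ v ∈ nbrIn G univ J) : Expanding (G.induce Lᶜ) := by
  intro I hne hI
  by_contra hle
  have h1 : nbrIn G univ (extendBy J I) ⊆
      nbrIn G univ J ∪ (nbrIn (G.induce Lᶜ) univ I).map (Function.Embedding.subtype _) := by
    intro b hb
    obtain ⟨-, a, ha, hab⟩ := mem_nbrIn.1 hb
    rw [mem_union]
    by_cases hbN : b ∈ nbrIn G univ J
    · exact Or.inl hbN
    rcases mem_extendBy.1 ha with ha | ⟨ha, ha'⟩
    · exact absurd (mem_nbrIn.2 ⟨mem_univ _, a, ha, hab⟩) hbN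
    · have hbL : b ∈ Lᶜ := fun h => by
        rcases (hL b).1 h with h | h
        · exact ha ((hL a).2 (Or.inr (mem_nbrIn.2 ⟨mem_univ _, b, h, hab.symm⟩)))
        · exact hbN h
      exact Or.inr (mem_map.2 ⟨⟨b, hbL⟩, mem_nbrIn.2 ⟨mem_univ _, ⟨a, ha⟩, ha', hab⟩, rfl⟩)
  have h2 := (card_le_card h1).trans (card_union_le _ _)
  rw [card_map] at h2
  have h3 := card_extendBy hL I
  -- If `I` failed to expand, `J ∪ I` would be critical too, and larger than `J`.
  have h4 := hJ.card_le (isIndepSet_extendBy hJ.1.1 hL hI) (by omega)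
  have h5 := card_pos.2 hne
  omega

theorem IsCriticalIndepSet.mem_corona_iff (hJ : IsCriticalIndepSet G J)
    (hL : ∀ v, v ∈ L ↔ v ∈ J ∨ v ∈ nbrIn G univ J) (w : ↥Lᶜ) :
    (w : V) ∈ corona G ↔ w ∈ corona (G.induce Lᶜ) := by
  constructor
  · rintro ⟨S, hS, hw⟩
    exact ⟨_, hJ.isMaximumIndepSet_subtype hL hS, mem_subtype.2 hw⟩
  · rintro ⟨T, hT, hw⟩
    exact ⟨_, hJ.isMaximumIndepSet_extendBy hL hT, mem_extendBy.2 (Or.inr ⟨w.2, hw⟩)⟩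

theorem IsCriticalIndepSet.mem_nbhd_core_iff (hJ : IsCriticalIndepSet G J)
    (hL : ∀ v, v ∈ L ↔ v ∈ J ∨ v ∈ nbrIn G univ J) (w : ↥Lᶜ) :
    (w : V) ∈ nbhd G (core G) ↔ w ∈ nbhd (G.induce Lᶜ) (core (G.induce Lᶜ)) := by
  rw [mem_nbhd, mem_nbhd]
  constructor
  · rintro ⟨a, ha, haw⟩
    have haJ : a ∉ J := fun h =>
      w.2 ((hL _).2 (Or.inr (mem_nbrIn.2 ⟨mem_univ _, a, h, haw⟩)))
    have key : ∀ T, (G.induce Lᶜ).IsMaximumIndepSet T → ∃ h : a ∈ Lᶜ, (⟨a, h⟩ : ↥Lᶜ) ∈ T :=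
      fun T hT => (mem_extendBy.1 (ha _ (hJ.isMaximumIndepSet_extendBy hL hT))).resolve_left haJ
    -- One maximum independent set is needed to know that `a` lies outside `L`.
    obtain ⟨T, hT⟩ := maximumIndepSet_exists (G := G.induce Lᶜ)
    obtain ⟨haL, -⟩ := key T hT
    exact ⟨⟨a, haL⟩, fun T hT => (key T hT).2, haw⟩
  · rintro ⟨a, ha, haw⟩
    exact ⟨a, fun S hS => mem_subtype.1 (ha _ (hJ.isMaximumIndepSet_subtype hL hS)), haw⟩

theorem IsCriticalIndepSet.mem_corona_of_mem (hJ : IsCriticalIndepSet G J)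
    (hL : ∀ v, v ∈ L ↔ v ∈ J ∨ v ∈ nbrIn G univ J) {v : V} (hv : v ∈ J) : v ∈ corona G := by
  obtain ⟨T, hT⟩ := maximumIndepSet_exists (G := G.induce Lᶜ)
  exact ⟨_, hJ.isMaximumIndepSet_extendBy hL hT, mem_extendBy.2 (Or.inl hv)⟩

/-- For maximum independent `S`, the set `S ∩ N(J)` attains equality in Hall's condition, with
neighborhood `J \ S`. The union over all `S` does so too. If `v` were uncovered, this union would
avoid `v` but already reach every neighbor of `v` in `J`, so adding `v` would violate Hall's
condition. -/
theorem IsCriticalIndepSet.mem_corona_or_mem_nbhd_core (hJ : IsCriticalIndepSet G J)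
    (hL : ∀ v, v ∈ L ↔ v ∈ J ∨ v ∈ nbrIn G univ J) {v : V} (hv : v ∈ nbrIn G univ J) :
    v ∈ corona G ∨ v ∈ nbhd G (core G) := by
  by_contra! hno
  let F : Finset (Finset V) :=
    ({S | G.IsMaximumIndepSet S} : Finset (Finset V)).image (· ∩ nbrIn G univ J)
  have hF : ∀ S, G.IsMaximumIndepSet S → S ∩ nbrIn G univ J ∈ F := fun S hS =>
    mem_image_of_mem _ (by simpa using hS)
  have htight : ∀ S, G.IsMaximumIndepSet S → nbrIn G J (S ∩ nbrIn G univ J) = J \ S := by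
    intro S hS
    refine eq_of_subset_of_card_le (fun b hb => ?_)
      ((hJ.card_sdiff_le hL hS).trans (hJ.card_le_card_nbrIn inter_subset_right))
    obtain ⟨hbJ, a, ha, hab⟩ := mem_nbrIn.1 hb
    exact mem_sdiff.2 ⟨hbJ, fun h => isIndepSet_iff_forall.1 hS.1 a (mem_inter.1 ha).1 b h hab⟩
  have hmem : ∀ Z ∈ F, ∃ S, G.IsMaximumIndepSet S ∧ S ∩ nbrIn G univ J = Z := fun Z hZ => by
    obtain ⟨S, hS, h⟩ := mem_image.1 hZ
    exact ⟨S, by simpa using hS, h⟩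
  obtain ⟨hsub, ht⟩ := tight_biUnion (fun Y hY => hJ.card_le_card_nbrIn hY) F fun Z hZ => by
    obtain ⟨S, hS, rfl⟩ := hmem Z hZ
    exact ⟨inter_subset_right, by rw [htight S hS]; exact hJ.card_sdiff_le hL hS⟩
  have hvT : v ∉ F.biUnion id := fun h => by
    obtain ⟨Z, hZ, hvZ⟩ := mem_biUnion.1 h
    obtain ⟨S, hS, rfl⟩ := hmem Z hZ
    exact hno.1 ⟨S, hS, (mem_inter.1 hvZ).1⟩
  have h1 := hJ.card_le_card_nbrIn (insert_subset hv hsub)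
  have h2 : nbrIn G J (insert v (F.biUnion id)) ⊆ nbrIn G J (F.biUnion id) := by
    intro s hs
    obtain ⟨hsJ, z, hz, hzs⟩ := mem_nbrIn.1 hs
    rcases mem_insert.1 hz with rfl | hz
    · have hcore : s ∉ core G := fun h => hno.2 (mem_nbhd.2 ⟨s, h, hzs.symm⟩)
      simp only [core, Set.mem_ofPred_eq, not_forall] at hcore
      obtain ⟨S, hS, hsS⟩ := hcore
      refine nbrIn_mono (subset_biUnion_of_mem id (hF S hS)) ?_
      change s ∈ nbrIn G J (S ∩ nbrIn G univ J)
      rw [htight S hS]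
      exact mem_sdiff.2 ⟨hsJ, hsS⟩
    · exact mem_nbrIn.2 ⟨hsJ, z, hz, hzs⟩
  have h3 := card_le_card h2
  rw [card_insert_of_notMem hvT] at h1
  omega

end

theorem disjoint_corona_nbhd_core : Disjoint (corona G) (nbhd G (core G)) := by
  rw [Set.disjoint_left]
  rintro v ⟨S, hS, hv⟩ h
  obtain ⟨a, ha, hav⟩ := mem_nbhd.1 h
  exact isIndepSet_iff_forall.1 hS.1 a (ha S hS) v hv hav

end Larson

end CoreCorona

theorem mainTheorem4 {V : Type*} [Finite V] (G : SimpleGraph V) (L : Set V)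
    (hL : CoreCorona.IsLarsonSet G L)
    (hodd : (CoreCorona.oddCycles (G.induce Lᶜ)).encard ≤ 2) :
    (CoreCorona.corona G ∪ CoreCorona.nbhd G (CoreCorona.core G) = Set.univ ∧
        Disjoint (CoreCorona.corona G) (CoreCorona.nbhd G (CoreCorona.core G))) ↔
      ¬ CoreCorona.HasOddCyclesSharingOneVertex (G.induce Lᶜ) := by
  classical
  have : Fintype V := Fintype.ofFinite V
  obtain ⟨J, hJ, hLJ⟩ := hL
  obtain ⟨J, rfl⟩ := J.toFinite.exists_finset_coe
  have hL : ∀ v, v ∈ L ↔ v ∈ J ∨ v ∈ CoreCorona.nbrIn G Finset.univ J := fun v => by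
    rw [hLJ, ← CoreCorona.coe_nbrIn_univ]
    rfl
  rw [← (hJ.expanding hL).forall_mem_corona_or_mem_nbhd_core_iff hodd,
    and_iff_left CoreCorona.disjoint_corona_nbhd_core, Set.eq_univ_iff_forall]
  constructor
  · intro h w
    rw [← hJ.1.mem_corona_iff hL, ← hJ.1.mem_nbhd_core_iff hL]
    exact h w
  · intro h v
    by_cases hv : v ∈ L
    · rcases (hL v).1 hv with hv | hv
      · exact Or.inl (hJ.1.mem_corona_of_mem hL hv)
      · exact hJ.1.mem_corona_or_mem_nbhd_core hL hv
    · have := h ⟨v, hv⟩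
      rwa [← hJ.1.mem_corona_iff hL, ← hJ.1.mem_nbhd_core_iff hL] at this
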